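/- Let $m,p,n\ge 1$ be integers with $p\mid m$. Let $G(m,p,n)$ be the group of $n\times n$ complex matrices having exactly one non-zero entry in each row and each column, all non-zero entries being $m$th roots of unity, and such that the $(m/p)$th power of the product of the non-zero entries is $1$. Let $K\subset\mathbb{C}$ be a subfield containing all entries of the matrices in $G(m,p,n)$, so that $G(m,p,n)\subset \mathrm{GL}_n(K)$ acts on $K[x_1,\dots,x_n]$ by $(\sigma\cdot f)(v)=f(\sigma^{-1}v)$. Let $\mathcal{I}$ be the coinvariant ideal, i.e. the ideal of $K[x_1,\dots,x_n]$ generated by the homogeneous $G(m,p,n)$-invariant polynomials of positive degree. Let $h_k(y_1,\dots,y_r)$ denote the complete homogeneous symmetric polynomial of degree $k$, and write $[n]=\{1,\dots,n\}$. A Gröbner basis of $\mathcal{I}$ is a finite subset of $\mathcal{I}$ whose leading terms generate the ideal generated by the leading terms of all elements of $\mathcal{I}$; it is reduced if all its elements have leading coefficient $1$ and the leading monomial of an element $g$ divides no monomial occurring in any other element. Then, with respect to the lexicographic order with $x_1>\cdots>x_n$, the ideal $\mathcal{I}$ has exactly one reduced Gröbner basis, namely: - if $p=1$: $\{h_j(x_j^m,\dots,x_n^m)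 : j\in[n]\}$; - if $p>1$: the disjoint union $\{h_j(x_j^m,\dots,x_n^m) : j\in[n-1]\}\ \sqcup\ \{h_{j-1}(x_j^m,\dots,x_n^m)\,(x_j\cdots x_n)^{m/p} : j\in[n]\}$. -/

import Mathlib

open scoped BigOperators

/-- The Shephard–Todd group `G(m, p, n)` inside `GL_n(F)`: the pseudo-permutation matrices, i.e.
matrices having exactly one non-zero entry in each row and column (entry `a j` at position
`(s j, j)` for a permutation `s`), all of whose non-zero entries are `m`-th roots of unity, and
such that the product of the non-zero entries raised to the power `m / p` is `1`. -/
def shephardToddGroup (F : Type*) [Field F] (m p n : ℕ) :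
    Subgroup (Matrix.GeneralLinearGroup (Fin n) F) where
  carrier := {A | ∃ (s : Equiv.Perm (Fin n)) (a : Fin n → Fˣ),
    (∀ j, a j ^ m = 1) ∧ (∏ j, a j) ^ (m / p) = 1 ∧
    ∀ i j, (A : Matrix (Fin n) (Fin n) F) i j = if i = s j then (a j : F) else 0}
  one_mem' := by
    refine ⟨1, fun _ => 1, by simp, by simp, fun i j => ?_⟩
    simp [Matrix.one_apply]
    congr
  mul_mem' := by
    rintro A B ⟨s, a, ha, ha', hA⟩ ⟨t, b, hb, hb', hB⟩
    refine ⟨s * t, fun j => a (t j) * b j, fun j => ?_, ?_, fun i j => ?_⟩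
    · rw [mul_pow, ha, hb, one_mul]
    · rw [Finset.prod_mul_distrib, Equiv.prod_comp t a, mul_pow, ha', hb', one_mul]
    · rw [Matrix.GeneralLinearGroup.coe_mul, Matrix.mul_apply]
      simp [hA, hB]
      congr
  inv_mem' := by
    rintro A ⟨s, a, ha, ha', hA⟩
    refine ⟨s⁻¹, fun j => (a (s⁻¹ j))⁻¹, fun j => ?_, ?_, ?_⟩
    · rw [inv_pow, ha, inv_one]
    · rw [Finset.prod_inv_distrib, Equiv.prod_comp s⁻¹ a, inv_pow, ha', inv_one]
    · have h : (A : Matrix (Fin n) (Fin n) F) *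
          (Matrix.of fun i j => if i = s⁻¹ j then (((a (s⁻¹ j))⁻¹ : Fˣ) : F) else 0) = 1 := by
        ext i j
        rw [Matrix.mul_apply]
        simp [hA, Matrix.one_apply]
      have h' := Units.inv_eq_of_mul_eq_one_right h
      intro i j
      rw [h']
      rfl

/-- The contragredient action of a matrix `g` on polynomial functions on `Fⁿ`,
`(g • f)(v) = f(g⁻¹ v)`: the algebra map with `x_j ↦ ∑ i, (g⁻¹)_{j i} x_i`. -/
noncomputable def polyAct {F : Type*} [Field F] {n : ℕ}
    (g : Matrix.GeneralLinearGroup (Fin n) F) :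
    MvPolynomial (Fin n) F →ₐ[F] MvPolynomial (Fin n) F :=
  MvPolynomial.aeval fun j =>
    ∑ i, MvPolynomial.C ((g⁻¹ : Matrix.GeneralLinearGroup (Fin n) F) j i) * MvPolynomial.X i

/-- The coinvariant ideal of a matrix group `G`: the ideal of `F[x_1, …, x_n]` generated by the
homogeneous `G`-invariant polynomials of positive degree. -/
noncomputable def coinvariantIdeal {F : Type*} [Field F] {n : ℕ}
    (G : Subgroup (Matrix.GeneralLinearGroup (Fin n) F)) : Ideal (MvPolynomial (Fin n) F) :=
  Ideal.span {f | (∃ d, 0 < d ∧ f.IsHomogeneous d) ∧ ∀ g ∈ G, polyAct g f = f}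

/-- `S` is a Gröbner basis of the ideal `I` for the monomial order `μ`: a finite subset of `I`
whose leading terms generate the ideal of leading terms of `I`. -/
structure IsGroebnerBasis {F σ : Type*} [Field F] (μ : MonomialOrder σ)
    (I : Ideal (MvPolynomial σ F)) (S : Set (MvPolynomial σ F)) : Prop where
  finite : S.Finite
  subset : S ⊆ (I : Set (MvPolynomial σ F))
  span_leadingTerm : Ideal.span (μ.leadingTerm '' S) =
    Ideal.span (μ.leadingTerm '' (I : Set (MvPolynomial σ F)))

/-- A reduced Gröbner basis: every element has leading coefficient `1`, and the leading monomial of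
an element `g` divides no monomial occurring in another element `h`. -/
structure IsReducedGroebnerBasis {F σ : Type*} [Field F] (μ : MonomialOrder σ)
    (I : Ideal (MvPolynomial σ F)) (S : Set (MvPolynomial σ F)) : Prop
    extends IsGroebnerBasis μ I S where
  monic : ∀ g ∈ S, μ.Monic g
  reduced : ∀ g ∈ S, ∀ h ∈ S, h ≠ g → ∀ c ∈ h.support, ¬ μ.degree g ≤ c

/-- The polynomial `h_k(x_i^m, x_{i+1}^m, …)`: the complete homogeneous symmetric polynomial of
degree `k` in the `m`-th powers of the variables with index at least `i`. -/
noncomputable def hTail (F : Type*) [Field F] {n : ℕ} (m : ℕ) (i : Fin n) (k : ℕ) :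
    MvPolynomial (Fin n) F :=
  MvPolynomial.aeval (fun l : {l : Fin n // i ≤ l} => (MvPolynomial.X l.1 : MvPolynomial (Fin n) F) ^ m)
    (MvPolynomial.hsymm {l : Fin n // i ≤ l} F k)

/-- The product `x_i x_{i+1} ⋯` of all variables with index at least `i`. -/
noncomputable def xTail (F : Type*) [Field F] {n : ℕ} (i : Fin n) : MvPolynomial (Fin n) F :=
  ∏ l : {l : Fin n // i ≤ l}, MvPolynomial.X l.1

/-- `{h_j(x_j^m, …, x_n^m) : 1 ≤ j ≤ N}`; the index `i : Fin n` stands for `j = i + 1`. -/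
def hSet (F : Type*) [Field F] (n m N : ℕ) : Set (MvPolynomial (Fin n) F) :=
  {f | ∃ i : Fin n, (i : ℕ) + 1 ≤ N ∧ f = hTail F m i (i + 1)}

/-- `{h_{j-1}(x_j^m, …, x_n^m) (x_j ⋯ x_n)^{m/p} : 1 ≤ j ≤ n}`; the index `i : Fin n` stands for
`j = i + 1`. -/
def hxSet (F : Type*) [Field F] (n m p : ℕ) : Set (MvPolynomial (Fin n) F) :=
  {f | ∃ i : Fin n, f = hTail F m i i * xTail F i ^ (m / p)}

/-! ### Gröbner bases through divisibility of leading monomials, and uniqueness of reduced ones -/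

section GroebnerBasis

variable {F σ : Type*} [Field F] {μ : MonomialOrder σ} {I : Ideal (MvPolynomial σ F)}
  {S T : Set (MvPolynomial σ F)}

/-! The proof is a count against the group order |G| = n! m^n / p.

Upper bound: the recurrence `hTail_succ` carries the invariants h_k(x_1^m, …, x_n^m) and (x_1 ⋯
x_n)^{m/p} to the listed polynomials, which therefore lie in the coinvariant ideal
(`hTail_mem_coinvariantIdeal`, `hTail_mul_xTail_mem_coinvariantIdeal`). Their lex-leading monomials
are explicit, and at most |G| monomials are divisible by none of them (`card_boxExponents_le`,
`card_stairExponents_le`).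

Lower bound: the ideal has at least |G| standard monomials. Invariants are constant on a free orbit,
so by induction on the degree the values of standard monomials on the orbit span the values of all
polynomials (`evalAt_mem_span_standard`), hence all functions on the orbit (`evalAt_surjective`). An
element of the ideal whose leading monomial is missed by the list would leave fewer than |G|
standard monomials (`exists_degree_le_of_card_le`).

Reducedness is a comparison of exponents, and a reduced basis is unique for any monomial order
(`IsReducedGroebnerBasis.subset_of_isReduced`). -/

theorem IsGroebnerBasis.exists_degree_le (h : IsGroebnerBasis μ I S) {f : MvPolynomial σ F}
    (hf : f ∈ I) (hf0 : f ≠ 0) : ∃ g ∈ S, μ.degree g ≤ μ.degree f := by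
  have h1 : μ.leadingTerm f ∈ Ideal.span (μ.leadingTerm '' S) := by
    rw [h.span_leadingTerm]
    exact Ideal.subset_span ⟨f, hf, rfl⟩
  have h2 : Ideal.span (μ.leadingTerm '' S) ≤
      Ideal.span ((fun s => MvPolynomial.monomial s (1 : F)) '' (μ.degree '' S)) := by
    rw [Ideal.span_le]
    rintro _ ⟨g, hg, rfl⟩
    have : μ.leadingTerm g =
        MvPolynomial.C (μ.leadingCoeff g) * MvPolynomial.monomial (μ.degree g) 1 := by
      rw [MvPolynomial.C_mul_monomial, mul_one]
      rfl
    rw [SetLike.mem_coe, this]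
    exact Ideal.mul_mem_left _ _ (Ideal.subset_span ⟨_, ⟨g, hg, rfl⟩, rfl⟩)
  obtain ⟨_, ⟨g, hg, rfl⟩, hle⟩ := MvPolynomial.mem_ideal_span_monomial_image.1 (h2 h1)
    (μ.degree f) (by simp [μ.support_leadingTerm' hf0])
  exact ⟨g, hg, hle⟩

theorem IsGroebnerBasis.of_exists_degree_le (hfin : S.Finite)
    (hsub : S ⊆ (I : Set (MvPolynomial σ F))) (hmonic : ∀ g ∈ S, μ.Monic g)
    (h : ∀ f ∈ I, f ≠ 0 → ∃ g ∈ S, μ.degree g ≤ μ.degree f) : IsGroebnerBasis μ I S where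
  finite := hfin
  subset := hsub
  span_leadingTerm := by
    refine le_antisymm (Ideal.span_mono (Set.image_mono hsub)) ?_
    rw [Ideal.span_le]
    rintro _ ⟨f, hf, rfl⟩
    by_cases hf0 : f = 0
    · simp [hf0]
    obtain ⟨g, hg, hle⟩ := h f hf hf0
    have : μ.leadingTerm f = MvPolynomial.monomial (μ.degree f - μ.degree g) (μ.leadingCoeff f) *
        μ.leadingTerm g := by
      rw [MonomialOrder.leadingTerm, MonomialOrder.leadingTerm, (hmonic g hg).leadingCoeff_eq_one,
        MvPolynomial.monomial_mul, mul_one, tsub_add_cancel_of_le hle]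
    rw [SetLike.mem_coe, this]
    exact Ideal.mul_mem_left _ _ (Ideal.subset_span ⟨g, hg, rfl⟩)

theorem IsReducedGroebnerBasis.eq_of_degree_le (hS : IsReducedGroebnerBasis μ I S)
    {g h : MvPolynomial σ F} (hg : g ∈ S) (hh : h ∈ S) {c : σ →₀ ℕ} (hc : c ∈ h.support)
    (hle : μ.degree g ≤ c) : h = g :=
  by_contra fun hne => hS.reduced g hg h hh hne c hc hle

/-- Mutual divisibility pairs each g in S with some t in T of the same leading monomial. If g - t
were non-zero, its leading monomial would occur in g or in t, strictly below the common leading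
monomial, and be divisible by the leading monomial of a basis element. Reducedness forces that
element to be g or t itself, which is too large. -/
theorem IsReducedGroebnerBasis.subset_of_isReduced (hS : IsReducedGroebnerBasis μ I S)
    (hT : IsReducedGroebnerBasis μ I T) : S ⊆ T := by
  intro g hg
  obtain ⟨t, ht, htg⟩ := hT.exists_degree_le (hS.subset hg) (hS.monic g hg).ne_zero
  obtain ⟨g', hg', hgt⟩ := hS.exists_degree_le (hT.subset ht) (hT.monic t ht).ne_zero
  obtain rfl : g = g' := hS.eq_of_degree_le hg' hg
    (μ.degree_mem_support (hS.monic g hg).ne_zero) (hgt.trans htg)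
  have hdeg : μ.degree t = μ.degree g := le_antisymm htg hgt
  suffices g - t = 0 by rwa [sub_eq_zero.1 this]
  by_contra hne
  have hmem : g - t ∈ I := I.sub_mem (hS.subset hg) (hT.subset ht)
  have hsupp := μ.degree_mem_support hne
  have hcoeff : (g - t).coeff (μ.degree g) = 0 := by
    rw [MvPolynomial.coeff_sub, (hS.monic g hg).coeff_degree, ← hdeg,
      (hT.monic t ht).coeff_degree, sub_self]
  have hne' : μ.degree (g - t) ≠ μ.degree g := fun h => by
    rw [← h] at hcoeff
    exact MvPolynomial.mem_support_iff.1 hsupp hcoeff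
  classical
  rcases Finset.mem_union.1 (MvPolynomial.support_sub σ g t hsupp) with hc | hc
  · obtain ⟨a, ha, hle⟩ := hS.exists_degree_le hmem hne
    obtain rfl := hS.eq_of_degree_le ha hg hc hle
    exact hne' (μ.toSyn.injective (le_antisymm (μ.le_degree hc) (μ.toSyn_monotone hle)))
  · obtain ⟨a, ha, hle⟩ := hT.exists_degree_le hmem hne
    obtain rfl := hT.eq_of_degree_le ha ht hc hle
    rw [← hdeg] at hne'
    exact hne' (μ.toSyn.injective (le_antisymm (μ.le_degree hc) (μ.toSyn_monotone hle)))

theorem IsReducedGroebnerBasis.iff_eq (hT : IsReducedGroebnerBasis μ I T) :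
    IsReducedGroebnerBasis μ I S ↔ S = T :=
  ⟨fun hS => (hS.subset_of_isReduced hT).antisymm (hT.subset_of_isReduced hS), fun h => h ▸ hT⟩

end GroebnerBasis

/-! ### Standard monomials and evaluation at finitely many points -/

section PointEvaluation

open MvPolynomial

variable {F σ ι : Type*} [Field F] {μ : MonomialOrder σ}

/-- Evaluation of polynomials at a family of points. -/
noncomputable def evalAt (w : ι → σ → F) : MvPolynomial σ F →ₗ[F] (ι → F) :=
  LinearMap.pi fun i => (aeval (w i)).toLinearMap

@[simp]
theorem evalAt_apply (w : ι → σ → F) (f : MvPolynomial σ F) (i : ι) :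
    evalAt w f i = eval (w i) f := by
  simp [evalAt, aeval_eq_eval]

/-- Lagrange interpolation: products of affine-linear forms separating pairs of points give the
indicator functions. -/
theorem evalAt_surjective [Finite ι] {w : ι → σ → F} (hw : Function.Injective w) :
    Function.Surjective (evalAt w) := by
  classical
  cases nonempty_fintype ι
  have hsep : ∀ i j, ∃ f : MvPolynomial σ F, eval (w i) f = 1 ∧ (j ≠ i → eval (w j) f = 0) := by
    intro i j
    by_cases h : j = i
    · exact ⟨1, by simp, fun h' => absurd h h'⟩
    obtain ⟨s, hs⟩ := Function.ne_iff.1 (hw.ne h)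
    refine ⟨C (w i s - w j s)⁻¹ * (X s - C (w j s)), ?_, fun _ => by simp⟩
    have : w i s - w j s ≠ 0 := sub_ne_zero.2 (Ne.symm hs)
    simp [this]
  choose f hf1 hf0 using hsep
  intro v
  refine ⟨∑ i, C (v i) * ∏ j, f i j, ?_⟩
  ext k
  rw [evalAt_apply, map_sum, Finset.sum_eq_single k]
  · simp [map_prod, hf1]
  · intro i _ hik
    rw [map_mul, map_prod, Finset.prod_eq_zero (Finset.mem_univ k) (hf0 i k (Ne.symm hik)),
      mul_zero]
  · simp

/-- A generator t acts on values as a scalar, being constant on the points. Since t has positive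
degree, its cofactor in the degree `d` component has degree below `d`, where `hW` applies. -/
theorem evalAt_homogeneousComponent_mem {w : ι → σ → F} {T : Set (MvPolynomial σ F)}
    (hT : ∀ t ∈ T, ∃ d, 0 < d ∧ t.IsHomogeneous d)
    (hw : ∀ t ∈ T, ∀ i j, eval (w i) t = eval (w j) t) {W : Submodule F (ι → F)} {d : ℕ}
    (hW : ∀ e < d, ∀ u : MvPolynomial σ F, u.IsHomogeneous e → evalAt w u ∈ W)
    {f : MvPolynomial σ F} (hf : f ∈ Ideal.span T) :
    evalAt w (homogeneousComponent d f) ∈ W := by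
  -- The arbitrary multiplier `a` lets the span induction absorb scalar multiplication.
  suffices ∀ a : MvPolynomial σ F, evalAt w (homogeneousComponent d (a * f)) ∈ W by
    simpa using this 1
  induction hf using Submodule.span_induction with
  | zero => simp
  | add x y _ _ hx hy =>
    intro a
    rw [mul_add, map_add, map_add]
    exact W.add_mem (hx a) (hy a)
  | smul b x _ hx =>
    intro a
    rw [smul_eq_mul, ← mul_assoc]
    exact hx _
  | mem t ht =>
    intro a
    obtain ⟨e, he, hte⟩ := hT t ht
    conv in a * t => rw [← sum_homogeneousComponent a]
    rw [Finset.sum_mul, map_sum, map_sum]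
    refine W.sum_mem fun k _ => ?_
    have hk := homogeneousComponent_isHomogeneous k a
    rw [homogeneousComponent_of_mem (hk.mul hte)]
    split_ifs with hd
    · rcases isEmpty_or_nonempty ι with hι | ⟨⟨i₀⟩⟩
      · rw [Subsingleton.elim (evalAt w _) 0]
        exact W.zero_mem
      have : evalAt w (homogeneousComponent k a * t) =
          eval (w i₀) t • evalAt w (homogeneousComponent k a) := by
        ext i
        simp [hw t ht i i₀, mul_comm]
      rw [this]
      exact W.smul_mem _ (hW k (by omega) _ hk)
    · simp

/-- The values at `w` of the standard monomials of an ideal with homogeneous generators of positive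
degree that are constant on `w` span the values of all polynomials. -/
theorem evalAt_mem_span_standard {w : ι → σ → F} {T : Set (MvPolynomial σ F)}
    (hT : ∀ t ∈ T, ∃ d, 0 < d ∧ t.IsHomogeneous d)
    (hw : ∀ t ∈ T, ∀ i j, eval (w i) t = eval (w j) t) (f : MvPolynomial σ F) :
    evalAt w f ∈ Submodule.span F ((fun c => evalAt w (monomial c 1)) ''
      {c | ∀ g ∈ Ideal.span T, g ≠ 0 → ¬ μ.degree g ≤ c}) := by
  set W := Submodule.span F ((fun c => evalAt w (monomial c 1)) ''
      {c | ∀ g ∈ Ideal.span T, g ≠ 0 → ¬ μ.degree g ≤ c}) with hWdef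
  have key : ∀ d, ∀ u : MvPolynomial σ F, u.IsHomogeneous d → evalAt w u ∈ W := by
    intro d
    induction d using Nat.strong_induction_on with
    | _ d ih =>
    intro u hu
    -- Dividing by all non-zero elements of the ideal leaves a remainder made of standard monomials.
    obtain ⟨g, r, hur, -, hr⟩ := μ.div_set (B := {g | g ∈ Ideal.span T ∧ g ≠ 0})
      (fun b hb => (μ.leadingCoeff_ne_zero_iff.2 hb.2).isUnit) u
    have hg : Finsupp.linearCombination (MvPolynomial σ F)
        (fun b : {g | g ∈ Ideal.span T ∧ g ≠ 0} => (b : MvPolynomial σ F)) g ∈ Ideal.span T := by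
      rw [Finsupp.linearCombination_apply]
      exact Submodule.sum_mem _ fun b _ => Ideal.mul_mem_left _ _ b.2.1
    -- Neither part of the division need be homogeneous, so both are cut down to degree `d`; this
    -- only shrinks the support of `r`.
    have hu' := homogeneousComponent_eq_self hu
    rw [hur, map_add] at hu'
    rw [← hur] at hu'
    rw [← hu', map_add]
    refine W.add_mem (evalAt_homogeneousComponent_mem hT hw ih hg) ?_
    rw [(homogeneousComponent d r).as_sum, map_sum]
    refine W.sum_mem fun c hc => ?_
    have hcr : c ∈ r.support := by
      rw [support_homogeneousComponent] at hc
      exact (Finset.mem_filter.1 hc).1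
    rw [← mul_one (coeff c _), ← smul_eq_mul, ← smul_monomial, map_smul]
    exact W.smul_mem _ (Submodule.subset_span ⟨c, fun g hg hg0 => hr c hcr g ⟨hg, hg0⟩, rfl⟩)
  rw [← sum_homogeneousComponent f, map_sum]
  exact W.sum_mem fun d _ => key d _ (homogeneousComponent_isHomogeneous d f)

/-- A set of elements of the ideal whose leading monomials leave at most as many standard monomials
as there are points detects all leading monomials of the ideal. -/
theorem exists_degree_le_of_card_le [Finite ι] {w : ι → σ → F} (hinj : Function.Injective w)
    {T : Set (MvPolynomial σ F)} (hT : ∀ t ∈ T, ∃ d, 0 < d ∧ t.IsHomogeneous d)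
    (hw : ∀ t ∈ T, ∀ i j, eval (w i) t = eval (w j) t) {S : Set (MvPolynomial σ F)}
    (hS : S ⊆ (Ideal.span T : Set (MvPolynomial σ F))) (hS0 : ∀ g ∈ S, g ≠ 0)
    {D : Finset (σ →₀ ℕ)} (hD : ∀ c, (∀ g ∈ S, ¬ μ.degree g ≤ c) → c ∈ D)
    (hcard : D.card ≤ Nat.card ι) {f : MvPolynomial σ F} (hf : f ∈ Ideal.span T)
    (hf0 : f ≠ 0) : ∃ g ∈ S, μ.degree g ≤ μ.degree f := by
  classical
  cases nonempty_fintype ι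
  rw [Nat.card_eq_fintype_card] at hcard
  by_contra! hcon
  -- The exponent of `f` lies in `D` by `hcon` but is not standard, so one element of `D` is
  -- superfluous.
  have hsub : {c | ∀ g ∈ Ideal.span T, g ≠ 0 → ¬ μ.degree g ≤ c} ⊆
      (D.erase (μ.degree f) : Set (σ →₀ ℕ)) := by
    intro c hc
    rw [Finset.mem_coe, Finset.mem_erase]
    exact ⟨fun h => hc f hf hf0 h.ge, hD c fun g hg => hc g (hS hg) (hS0 g hg)⟩
  have htop : Submodule.span F
      (((D.erase (μ.degree f)).image fun c => evalAt w (monomial c 1) : Finset (ι → F)) :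
        Set (ι → F)) = ⊤ := by
    rw [eq_top_iff]
    intro v _
    obtain ⟨u, rfl⟩ := evalAt_surjective hinj v
    refine Submodule.span_mono ?_ (evalAt_mem_span_standard (μ := μ) hT hw u)
    rw [Finset.coe_image]
    exact Set.image_mono hsub
  have h1 := finrank_span_finset_le_card (R := F)
    ((D.erase (μ.degree f)).image fun c => evalAt w (monomial c 1) : Finset (ι → F))
  rw [Set.finrank, htop, finrank_top, Module.finrank_fintype_fun_eq_card] at h1
  have h2 := Finset.card_erase_lt_of_mem (hD _ hcon)
  have h3 := Finset.card_image_le (s := D.erase (μ.degree f))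
    (f := fun c => evalAt w (monomial c (1 : F)))
  omega

end PointEvaluation

/-! ### Complete homogeneous polynomials in the tail variables: recurrence and leading monomials -/

section TailPolynomials

open MvPolynomial

theorem MvPolynomial.prod_map_X_eq_monomial {σ R : Type*} [CommSemiring R] [DecidableEq σ]
    (s : Multiset σ) :
    (s.map (X : σ → MvPolynomial σ R)).prod = monomial (Multiset.toFinsupp s) 1 := by
  induction s using Multiset.induction_on with
  | empty => simp
  | cons a s ih =>
    rw [Multiset.map_cons, Multiset.prod_cons, ih, ← Multiset.singleton_add, map_add,
      Multiset.toFinsupp_singleton, X, monomial_mul, one_mul]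

theorem MvPolynomial.coeff_hsymm {σ R : Type*} [CommSemiring R] [Fintype σ] [DecidableEq σ]
    (k : ℕ) (d : σ →₀ ℕ) : coeff d (hsymm σ R k) = if d.degree = k then 1 else 0 := by
  have hcard : ∀ d : σ →₀ ℕ, Multiset.card (Finsupp.toMultiset d) = d.degree := fun d => by
    rw [Finsupp.card_toMultiset, Finsupp.degree_apply]
    rfl
  have hsum : hsymm σ R k = ∑ s : Sym σ k, monomial (Multiset.toFinsupp (s : Multiset σ)) 1 :=
    Finset.sum_congr rfl fun s _ => MvPolynomial.prod_map_X_eq_monomial _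
  rw [hsum, coeff_sum]
  simp only [coeff_monomial]
  split_ifs with h
  · refine (Finset.sum_eq_single (Sym.mk (Finsupp.toMultiset d) (by rw [hcard, h]))
      ?_ ?_).trans ?_
    · rintro ⟨s, hs⟩ _ hne
      rw [if_neg]
      rintro rfl
      exact hne (Subtype.ext (by simp))
    · exact fun h' => absurd (Finset.mem_univ _) h'
    · simp
  · refine Finset.sum_eq_zero fun s _ => if_neg ?_
    rintro rfl
    apply h
    rw [← hcard, Multiset.toFinsupp_toMultiset]
    exact s.2

variable {F : Type*} [Field F] {n : ℕ}

/-- The complete homogeneous symmetric polynomial of degree `k` in the variables with index at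
least `i`. -/
noncomputable def hsymmTail (F : Type*) [Field F] {n : ℕ} (i : Fin n) (k : ℕ) :
    MvPolynomial (Fin n) F :=
  rename Subtype.val (hsymm {l : Fin n // i ≤ l} F k)

/-- Reduces coefficients and supports to the case of exponent 1. -/
theorem hTail_eq_expand (m : ℕ) (i : Fin n) (k : ℕ) :
    hTail F m i k = expand m (hsymmTail F i k) := by
  rw [hTail, hsymmTail, expand, bind₁, aeval_rename]
  rfl

theorem coeff_hsymmTail (i : Fin n) (k : ℕ) (c : Fin n →₀ ℕ) [Decidable (∀ l < i, c l = 0)] :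
    coeff c (hsymmTail F i k) = if (∀ l < i, c l = 0) ∧ c.degree = k then 1 else 0 := by
  by_cases h : ∀ l < i, c l = 0
  · obtain ⟨d, rfl⟩ : ∃ d : {l : Fin n // i ≤ l} →₀ ℕ, c = d.mapDomain Subtype.val := by
      refine ⟨c.comapDomain Subtype.val Subtype.val_injective.injOn,
        (Finsupp.mapDomain_comapDomain _ Subtype.val_injective _ ?_).symm⟩
      intro l hl
      rw [Finset.mem_coe, Finsupp.mem_support_iff] at hl
      exact ⟨⟨l, not_lt.1 fun hli => hl (h l hli)⟩, rfl⟩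
    rw [hsymmTail, coeff_rename_mapDomain _ Subtype.val_injective, coeff_hsymm,
      Finsupp.degree_mapDomain]
    exact if_congr (and_iff_right h).symm rfl rfl
  · rw [if_neg fun h' => h h'.1]
    refine coeff_rename_eq_zero _ _ _ fun u hu => absurd ?_ h
    intro l hl
    rw [← hu]
    refine Finsupp.mapDomain_of_notMem_range _ _ ?_
    rintro ⟨⟨l', hl'⟩, rfl⟩
    exact absurd hl (not_lt.2 hl')

/-- The monomials are split according to whether x_i occurs. -/
theorem hsymmTail_succ (i j : Fin n) (hij : (j : ℕ) = i + 1) (k : ℕ) :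
    hsymmTail F i (k + 1) = hsymmTail F j (k + 1) + X i * hsymmTail F i k := by
  classical
  have hlt : ∀ l : Fin n, l < j ↔ l < i ∨ l = i := fun l => by
    simp only [Fin.lt_def, Fin.ext_iff]
    omega
  ext c
  rw [coeff_add, coeff_X_mul', coeff_hsymmTail, coeff_hsymmTail, coeff_hsymmTail]
  by_cases hci : c i = 0
  · have : (∀ l < j, c l = 0) ↔ ∀ l < i, c l = 0 := by
      simp only [hlt]
      exact ⟨fun h l hl => h l (Or.inl hl), fun h l hl => hl.elim (h l) fun h' => h' ▸ hci⟩
    simp [this, hci]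
  · obtain ⟨c', rfl⟩ : ∃ c', c = c' + Finsupp.single i 1 :=
      ⟨c - Finsupp.single i 1,
        (tsub_add_cancel_of_le (Finsupp.single_le_iff.2 (Nat.one_le_iff_ne_zero.2 hci))).symm⟩
    have hj : ¬ ((∀ l < j, (c' + Finsupp.single i 1 : Fin n →₀ ℕ) l = 0) ∧
        (c' + Finsupp.single i 1 : Fin n →₀ ℕ).degree = k + 1) := fun h =>
      hci (h.1 i ((hlt i).2 (Or.inr rfl)))
    rw [if_neg hj, zero_add, if_pos (Finsupp.mem_support_iff.2 hci), add_tsub_cancel_right, map_add,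
      Finsupp.degree_single]
    refine if_congr (and_congr (forall₂_congr fun l hl => ?_) (by omega)) rfl rfl
    simp [hl.ne']

theorem hTail_succ (m : ℕ) (i j : Fin n) (hij : (j : ℕ) = i + 1) (k : ℕ) :
    hTail F m i (k + 1) = hTail F m j (k + 1) + X i ^ m * hTail F m i k := by
  simp only [hTail_eq_expand, hsymmTail_succ i j hij k, map_add, map_mul, expand_X]

theorem hTail_zero_right (m : ℕ) (i : Fin n) : hTail F m i 0 = 1 := by
  simp [hTail]

theorem hTail_of_val_eq_zero (m : ℕ) (i : Fin n) (hi : (i : ℕ) = 0) (k : ℕ) :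
    hTail F m i k = aeval (fun l => (X l : MvPolynomial (Fin n) F) ^ m) (hsymm (Fin n) F k) := by
  have h : ∀ l : Fin n, i ≤ l := fun l => by
    rw [Fin.le_def]
    omega
  rw [← rename_hsymm _ _ k (Equiv.subtypeUnivEquiv h), aeval_rename]
  rfl

theorem mem_support_hTail {m : ℕ} (hm : m ≠ 0) {i : Fin n} {k : ℕ} {c : Fin n →₀ ℕ} :
    c ∈ (hTail F m i k).support ↔
      ∃ d : Fin n →₀ ℕ, (∀ l < i, d l = 0) ∧ d.degree = k ∧ c = m • d := by
  classical
  rw [hTail_eq_expand, support_expand _ hm, Finset.mem_image]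
  refine exists_congr fun d => ?_
  rw [mem_support_iff, coeff_hsymmTail]
  simp [and_assoc, eq_comm]

theorem isHomogeneous_hTail {m : ℕ} (hm : m ≠ 0) (i : Fin n) (k : ℕ) :
    (hTail F m i k).IsHomogeneous (m * k) := by
  intro c hc
  obtain ⟨d, -, rfl, rfl⟩ := (mem_support_hTail hm).1 (mem_support_iff.2 hc)
  change Finsupp.weight (fun _ => 1) (m • d) = _
  rw [← Finsupp.degree_eq_weight_one]
  simp

theorem MvPolynomial.degree_lex_eq {f : MvPolynomial (Fin n) F} {e : Fin n →₀ ℕ}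
    (he : e ∈ f.support)
    (h : ∀ c ∈ f.support, c ≠ e → ∃ i, (∀ l < i, c l = e l) ∧ c i < e i) :
    MonomialOrder.lex.degree f = e := by
  apply MonomialOrder.lex.toSyn.injective
  refine le_antisymm ?_ (MonomialOrder.lex.le_degree he)
  rw [MonomialOrder.degree_le_iff]
  intro c hc
  by_cases hce : c = e
  · rw [hce]
  · rw [MonomialOrder.lex_le_iff]
    exact le_of_lt (Finsupp.Lex.lt_iff.2 (h c hc hce))

theorem Finsupp.eq_single_of_degree_le {σ : Type*} {d : σ →₀ ℕ} {i : σ} (h : d.degree ≤ d i) :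
    d = Finsupp.single i d.degree := by
  obtain ⟨r, hr⟩ := exists_add_of_le (Finsupp.single_le_iff.2 h)
  have hdeg := congrArg Finsupp.degree hr
  rw [map_add, Finsupp.degree_single] at hdeg
  rwa [(Finsupp.degree_eq_zero_iff r).1 (by omega), add_zero] at hr

theorem degree_hTail {m : ℕ} (hm : m ≠ 0) (i : Fin n) (k : ℕ) :
    MonomialOrder.lex.degree (hTail F m i k) = Finsupp.single i (m * k) := by
  refine MvPolynomial.degree_lex_eq ?_ ?_
  · refine (mem_support_hTail hm).2 ⟨Finsupp.single i k, fun l hl => ?_, ?_, ?_⟩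
    · simp [hl.ne']
    · simp
    · simp
  · intro c hc hne
    obtain ⟨d, hd, rfl, rfl⟩ := (mem_support_hTail hm).1 hc
    refine ⟨i, fun l hl => ?_, ?_⟩
    · simp [hd l hl, hl.ne']
    · have hle : d i ≤ d.degree := Finsupp.le_degree i d
      rw [Finsupp.single_eq_same, Finsupp.smul_apply, smul_eq_mul]
      refine Nat.mul_lt_mul_of_pos_left (lt_of_le_of_ne hle fun h => hne ?_) (Nat.pos_of_ne_zero hm)
      conv_lhs => rw [Finsupp.eq_single_of_degree_le h.ge]
      simp

theorem monic_hTail {m : ℕ} (hm : m ≠ 0) (i : Fin n) (k : ℕ) :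
    MonomialOrder.lex.Monic (hTail F m i k) := by
  classical
  have h : Finsupp.single i (m * k) = m • Finsupp.single i k := by simp
  rw [MonomialOrder.Monic, MonomialOrder.leadingCoeff, degree_hTail hm, h, hTail_eq_expand,
    coeff_expand_smul _ hm, coeff_hsymmTail, if_pos]
  refine ⟨fun l hl => ?_, Finsupp.degree_single i k⟩
  simp [hl.ne']

/-- The exponent of the monomial `x_i x_{i+1} ⋯`. -/
noncomputable def tailExponent (i : Fin n) : Fin n →₀ ℕ :=
  Finsupp.equivFunOnFinite.symm fun l => if i ≤ l then 1 else 0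

@[simp]
theorem tailExponent_apply (i l : Fin n) : tailExponent i l = if i ≤ l then 1 else 0 := rfl

theorem xTail_eq_prod (i : Fin n) :
    xTail F i = ∏ l : Fin n, if i ≤ l then (X l : MvPolynomial (Fin n) F) else 1 := by
  rw [xTail, ← Finset.prod_filter, ← Finset.prod_subtype_eq_prod_filter, Finset.subtype_univ]

theorem xTail_eq_monomial (i : Fin n) : xTail F i = monomial (tailExponent i) 1 := by
  rw [xTail_eq_prod, monomial_eq, C_1, one_mul, Finsupp.prod_fintype _ _ (by simp)]
  refine Finset.prod_congr rfl fun l _ => ?_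
  simp only [tailExponent_apply]
  split_ifs <;> simp

theorem xTail_succ (i j : Fin n) (hij : (j : ℕ) = i + 1) :
    xTail F i = X i * xTail F j := by
  rw [xTail_eq_monomial, xTail_eq_monomial, X, monomial_mul, one_mul]
  congr 2
  ext l
  simp only [Finsupp.add_apply, tailExponent_apply, Finsupp.single_apply, Fin.le_def, Fin.ext_iff]
  split_ifs <;> omega

theorem xTail_pow_eq_monomial (i : Fin n) (q : ℕ) :
    xTail F i ^ q = monomial (q • tailExponent i) 1 := by
  rw [xTail_eq_monomial, monomial_pow, one_pow]

theorem monic_xTail_pow (i : Fin n) (q : ℕ) : MonomialOrder.lex.Monic (xTail F i ^ q) := by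
  rw [xTail_pow_eq_monomial]
  exact MonomialOrder.monic_monomial_one

theorem monic_hTail_mul_xTail {m : ℕ} (hm : m ≠ 0) (i : Fin n) (k q : ℕ) :
    MonomialOrder.lex.Monic (hTail F m i k * xTail F i ^ q) :=
  (monic_hTail hm i k).mul (monic_xTail_pow i q)

theorem degree_hTail_mul_xTail {m : ℕ} (hm : m ≠ 0) (i : Fin n) (k q : ℕ) :
    MonomialOrder.lex.degree (hTail F m i k * xTail F i ^ q) =
      Finsupp.single i (m * k) + q • tailExponent i := by
  classical
  rw [MonomialOrder.degree_mul (monic_hTail hm i k).ne_zero (monic_xTail_pow i q).ne_zero,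
    degree_hTail hm, xTail_pow_eq_monomial, MonomialOrder.degree_monomial, if_neg one_ne_zero]

theorem exists_of_mem_support_hTail_mul_xTail {m : ℕ} (hm : m ≠ 0) {i : Fin n} {k q : ℕ}
    {c : Fin n →₀ ℕ} (hc : c ∈ (hTail F m i k * xTail F i ^ q).support) :
    ∃ d : Fin n →₀ ℕ, (∀ l < i, d l = 0) ∧ d.degree = k ∧ c = m • d + q • tailExponent i := by
  rw [xTail_pow_eq_monomial, mem_support_iff, coeff_mul_monomial', mul_one] at hc
  split_ifs at hc with hle
  · obtain ⟨d, h1, h2, h3⟩ := (mem_support_hTail hm).1 (mem_support_iff.2 hc)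
    exact ⟨d, h1, h2, by rw [← h3, tsub_add_cancel_of_le hle]⟩
  · exact absurd rfl hc

end TailPolynomials

/-! ### Invariance and membership in the coinvariant ideal -/

section ShephardTodd

open MvPolynomial

variable {F : Type*} [Field F] {m p n : ℕ}

theorem exists_polyAct_X_of_mem {g : Matrix.GeneralLinearGroup (Fin n) F}
    (hg : g ∈ shephardToddGroup F m p n) :
    ∃ (t : Equiv.Perm (Fin n)) (b : Fin n → Fˣ), (∀ j, b j ^ m = 1) ∧ (∏ j, b j) ^ (m / p) = 1 ∧
      ∀ j, polyAct g (X j) = C (b j : F) * X (t j) := by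
  obtain ⟨s, a, ha, ha', hA⟩ := inv_mem hg
  refine ⟨s⁻¹, fun j => a (s⁻¹ j), fun j => ha _, ?_, fun j => ?_⟩
  · rw [Equiv.prod_comp s⁻¹ a, ha']
  · rw [polyAct, aeval_X, Finset.sum_eq_single (s⁻¹ j)]
    · rw [hA]
      simp
    · intro i _ hi
      rw [hA, if_neg, C_0, zero_mul]
      rintro rfl
      exact hi (by simp)
    · simp

theorem exists_mem_shephardToddGroup (s : Equiv.Perm (Fin n)) (a : Fin n → Fˣ)
    (ha : ∀ j, a j ^ m = 1) (ha' : (∏ j, a j) ^ (m / p) = 1) :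
    ∃ A ∈ shephardToddGroup F m p n, ∀ i j,
      (A : Matrix (Fin n) (Fin n) F) i j = if i = s j then (a j : F) else 0 := by
  have h : (Matrix.of fun i j => if i = s j then (a j : F) else 0) *
      (Matrix.of fun i j => if i = s⁻¹ j then (((a (s⁻¹ j))⁻¹ : Fˣ) : F) else 0) =
        (1 : Matrix (Fin n) (Fin n) F) := by
    ext i j
    rw [Matrix.mul_apply]
    simp [Matrix.one_apply]
  exact ⟨⟨_, _, h, mul_eq_one_comm.1 h⟩, ⟨s, a, ha, ha', fun i j => rfl⟩, fun i j => rfl⟩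

theorem exists_mem_polyAct_X (t : Equiv.Perm (Fin n)) (b : Fin n → Fˣ)
    (hb : ∀ j, b j ^ m = 1) (hb' : (∏ j, b j) ^ (m / p) = 1) :
    ∃ g ∈ shephardToddGroup F m p n, ∀ j, polyAct g (X j) = C (b j : F) * X (t j) := by
  obtain ⟨A, hA, hAij⟩ := exists_mem_shephardToddGroup (m := m) (p := p) t⁻¹
    (fun j => b (t⁻¹ j)) (fun j => hb _) (by rwa [Equiv.prod_comp t⁻¹ b])
  refine ⟨A⁻¹, inv_mem hA, fun j => ?_⟩
  rw [polyAct, aeval_X, inv_inv, Finset.sum_eq_single (t j)]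
  · rw [hAij]
    simp
  · intro i _ hi
    rw [hAij, if_neg, C_0, zero_mul]
    rintro rfl
    exact hi (by simp)
  · simp

theorem polyAct_hTail {g : Matrix.GeneralLinearGroup (Fin n) F}
    (hg : g ∈ shephardToddGroup F m p n) (i : Fin n) (hi : (i : ℕ) = 0) (k : ℕ) :
    polyAct g (hTail F m i k) = hTail F m i k := by
  obtain ⟨t, b, hb, -, h⟩ := exists_polyAct_X_of_mem hg
  have hX : ∀ j, polyAct g (X j ^ m) = X (t j) ^ m := fun j => by
    rw [map_pow, h, mul_pow, ← C_pow, ← Units.val_pow_eq_pow_val, hb, Units.val_one, C_1, one_mul]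
  rw [hTail_of_val_eq_zero m i hi, comp_aeval_apply]
  simp only [hX]
  conv_rhs => rw [← rename_hsymm _ _ k t, aeval_rename]
  rfl

theorem polyAct_xTail_pow {g : Matrix.GeneralLinearGroup (Fin n) F}
    (hg : g ∈ shephardToddGroup F m p n) (i : Fin n) (hi : (i : ℕ) = 0) :
    polyAct g (xTail F i ^ (m / p)) = xTail F i ^ (m / p) := by
  obtain ⟨t, b, -, hb, h⟩ := exists_polyAct_X_of_mem hg
  have h0 : xTail F i = ∏ l, X l := by
    rw [xTail_eq_prod]
    refine Finset.prod_congr rfl fun l _ => if_pos ?_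
    rw [Fin.le_def]
    omega
  have hb' : (∏ j, (b j : F)) ^ (m / p) = 1 := by
    rw [← Units.coe_prod, ← Units.val_pow_eq_pow_val, hb, Units.val_one]
  rw [h0, map_pow, map_prod]
  simp only [h]
  rw [Finset.prod_mul_distrib, ← map_prod, mul_pow, ← C_pow, hb', C_1, one_mul,
    Equiv.prod_comp t (X : Fin n → MvPolynomial (Fin n) F)]

/-- All degrees `k ≥ i + 1` are treated together because the recurrence for `i + 1` in degree `k`
uses the degrees `k` and `k - 1` for `i`. -/
theorem hTail_mem_coinvariantIdeal (hm : m ≠ 0) (i : ℕ) (hi : i < n) :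
    ∀ k, i + 1 ≤ k → hTail F m ⟨i, hi⟩ k ∈ coinvariantIdeal (shephardToddGroup F m p n) := by
  induction i with
  | zero =>
    exact fun k hk => Ideal.subset_span
      ⟨⟨m * k, by positivity, isHomogeneous_hTail hm _ k⟩, fun g hg => polyAct_hTail hg _ rfl k⟩
  | succ i ih =>
    intro k hk
    obtain ⟨k, rfl⟩ : ∃ k', k = k' + 1 := ⟨k - 1, by omega⟩
    have hi' : i < n := by omega
    have h := hTail_succ (F := F) m ⟨i, hi'⟩ ⟨i + 1, hi⟩ rfl k
    rw [← sub_eq_iff_eq_add] at h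
    rw [← h]
    exact Ideal.sub_mem _ (ih hi' _ (by omega)) (Ideal.mul_mem_left _ _ (ih hi' k (by omega)))

theorem hTail_mul_xTail_mem_coinvariantIdeal (hm : m ≠ 0) (hp : p ∣ m) (i : ℕ) (hi : i < n) :
    hTail F m ⟨i, hi⟩ i * xTail F ⟨i, hi⟩ ^ (m / p) ∈
      coinvariantIdeal (shephardToddGroup F m p n) := by
  have hq : 0 < m / p :=
    Nat.div_pos (Nat.le_of_dvd (by omega) hp) (Nat.pos_of_dvd_of_pos hp (by omega))
  induction i with
  | zero =>
    rw [hTail_zero_right, one_mul]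
    refine Ideal.subset_span ⟨⟨((m / p) • tailExponent (⟨0, hi⟩ : Fin n)).degree, ?_, ?_⟩,
      fun g hg => polyAct_xTail_pow hg _ rfl⟩
    · have := Finsupp.le_degree (⟨0, hi⟩ : Fin n) ((m / p) • tailExponent (⟨0, hi⟩ : Fin n))
      refine lt_of_lt_of_le ?_ this
      simpa using hq
    · rw [xTail_pow_eq_monomial]
      exact isHomogeneous_monomial _ rfl
  | succ i ih =>
    have hi' : i < n := by omega
    have h := hTail_succ (F := F) m ⟨i, hi'⟩ ⟨i + 1, hi⟩ rfl i
    have hx := xTail_succ (F := F) ⟨i, hi'⟩ ⟨i + 1, hi⟩ rfl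
    have hmq : (X ⟨i, hi'⟩ : MvPolynomial (Fin n) F) ^ m =
        X ⟨i, hi'⟩ ^ (m - m / p) * X ⟨i, hi'⟩ ^ (m / p) := by
      rw [← pow_add, Nat.sub_add_cancel (Nat.div_le_self m p)]
    -- The recurrence times the tail product; the factor x_i^{m/p} split off x_i^m completes the
    -- tail product to one starting at x_i.
    have key : hTail F m ⟨i + 1, hi⟩ (i + 1) * xTail F ⟨i + 1, hi⟩ ^ (m / p) =
        xTail F ⟨i + 1, hi⟩ ^ (m / p) * hTail F m ⟨i, hi'⟩ (i + 1) -
          X ⟨i, hi'⟩ ^ (m - m / p) * (hTail F m ⟨i, hi'⟩ i * xTail F ⟨i, hi'⟩ ^ (m / p)) := by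
      rw [h, hx, hmq]
      ring
    rw [key]
    exact Ideal.sub_mem _
      (Ideal.mul_mem_left _ _ (hTail_mem_coinvariantIdeal hm i hi' _ le_rfl))
      (Ideal.mul_mem_left _ _ (ih hi'))

end ShephardTodd

/-! ### A free orbit with coordinates in K -/

section Orbit

open MvPolynomial

variable {K : Subfield ℂ} {m p N : ℕ}

/-- Parameters for the elements of `G(m, p, N + 1)` with `q = m / p`: a permutation, all non-zero
entries but one, and the product of the non-zero entries. -/
abbrev OrbitIndex (m q N : ℕ) : Type :=
  Equiv.Perm (Fin (N + 1)) × (Fin N → rootsOfUnity m ℂ) × rootsOfUnity q ℂ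

theorem card_orbitIndex (m q N : ℕ) [NeZero m] [NeZero q] :
    Nat.card (OrbitIndex m q N) = (N + 1).factorial * (m ^ N * q) := by
  rw [Nat.card_prod, Nat.card_prod, Nat.card_perm, Nat.card_pi]
  simp only [Complex.card_rootsOfUnity, Nat.card_fin, Finset.prod_const, Finset.card_univ,
    Fintype.card_fin]

/-- The non-zero entries of the group element with the given parameters. -/
noncomputable def orbitEntry {m q N : ℕ} (x : OrbitIndex m q N) : Fin (N + 1) → ℂˣ :=
  Fin.cons ((x.2.2 : ℂˣ) * (∏ i, (x.2.1 i : ℂˣ))⁻¹) fun i => x.2.1 i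

theorem prod_orbitEntry {m q N : ℕ} (x : OrbitIndex m q N) :
    ∏ j, orbitEntry x j = (x.2.2 : ℂˣ) := by
  rw [orbitEntry, Fin.prod_cons, inv_mul_cancel_right]

theorem orbitEntry_pow (hp : p ∣ m) (x : OrbitIndex m (m / p) N) (j : Fin (N + 1)) :
    orbitEntry x j ^ m = 1 := by
  have h1 : ∀ i, (x.2.1 i : ℂˣ) ^ m = 1 := fun i => (x.2.1 i).2
  have h2 : (x.2.2 : ℂˣ) ^ m = 1 :=
    rootsOfUnity_le_of_dvd (Nat.div_dvd_of_dvd hp) x.2.2.2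
  refine Fin.cases ?_ (fun i => ?_) j
  · simp [orbitEntry, mul_pow, h2, ← Finset.prod_pow, h1]
  · exact h1 i

theorem prod_orbitEntry_pow (x : OrbitIndex m (m / p) N) :
    (∏ j, orbitEntry x j) ^ (m / p) = 1 := by
  rw [prod_orbitEntry]
  exact x.2.2.2

theorem orbitEntry_mem (hp : p ∣ m)
    (hK : ∀ A ∈ shephardToddGroup ℂ m p (N + 1), ∀ i j,
      (A : Matrix (Fin (N + 1)) (Fin (N + 1)) ℂ) i j ∈ K)
    (x : OrbitIndex m (m / p) N) (j : Fin (N + 1)) : (orbitEntry x j : ℂ) ∈ K := by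
  obtain ⟨A, hA, h⟩ := exists_mem_shephardToddGroup 1 (orbitEntry x) (orbitEntry_pow hp x)
    (prod_orbitEntry_pow x)
  have := hK A hA j j
  rwa [h, if_pos (by simp)] at this

/-- The base point is (1, 2, …, N + 1). Roots of unity have norm 1, so the norms of the coordinates
recover the permutation; dividing by the coordinates of the base point then recovers the entries. -/
theorem orbit_injective (hp : p ∣ m) (hm : m ≠ 0) : Function.Injective
    fun (x : OrbitIndex m (m / p) N) (j : Fin (N + 1)) =>
      (orbitEntry x j : ℂ) * (((x.1 j : ℕ) + 1 : ℕ) : ℂ) := by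
  intro x y hxy
  have hperm : x.1 = y.1 := by
    ext j
    have hj := congrArg norm (congrFun hxy j)
    have hone : ∀ z : OrbitIndex m (m / p) N, ‖(orbitEntry z j : ℂ)‖ = 1 := fun z => by
      refine Complex.norm_eq_one_of_pow_eq_one ?_ hm
      rw [← Units.val_pow_eq_pow_val, orbitEntry_pow hp, Units.val_one]
    simp only [norm_mul, hone, one_mul, Complex.norm_natCast] at hj
    have := Nat.cast_injective hj
    omega
  have hentry : orbitEntry x = orbitEntry y := by
    ext j
    have hj := congrFun hxy j
    simp only [hperm] at hj
    exact mul_right_cancel₀ (Nat.cast_ne_zero.2 (Nat.succ_ne_zero _)) hj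
  refine Prod.ext hperm (Prod.ext ?_ ?_)
  · funext i
    exact Subtype.ext (congrFun hentry i.succ)
  · refine Subtype.ext ?_
    rw [← prod_orbitEntry, ← prod_orbitEntry, hentry]

theorem exists_orbit_points (hp : p ∣ m) (hm : m ≠ 0)
    (hK : ∀ A ∈ shephardToddGroup ℂ m p (N + 1), ∀ i j,
      (A : Matrix (Fin (N + 1)) (Fin (N + 1)) ℂ) i j ∈ K) :
    ∃ w : OrbitIndex m (m / p) N → Fin (N + 1) → K, Function.Injective w ∧
      ∀ f : MvPolynomial (Fin (N + 1)) K,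
        (∀ g ∈ shephardToddGroup K m p (N + 1), polyAct g f = f) →
          ∀ x y, eval (w x) f = eval (w y) f := by
  set b : OrbitIndex m (m / p) N → Fin (N + 1) → K :=
    fun x j => ⟨orbitEntry x j, orbitEntry_mem hp hK x j⟩ with hb
  have hbpow : ∀ x j, b x j ^ m = 1 := fun x j => Subtype.ext (by
    simp [hb, ← Units.val_pow_eq_pow_val, orbitEntry_pow hp])
  have hbprod : ∀ x, (∏ j, b x j) ^ (m / p) = 1 := fun x => Subtype.ext (by
    simp [hb, ← Units.coe_prod, ← Units.val_pow_eq_pow_val, prod_orbitEntry_pow x])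
  have hb0 : ∀ x j, b x j ≠ 0 := fun x j h => by
    have := hbpow x j
    rw [h, zero_pow hm] at this
    exact zero_ne_one this
  set v : Fin (N + 1) → K := fun l => (((l : ℕ) + 1 : ℕ) : K)
  refine ⟨fun x j => b x j * v (x.1 j), fun x y hxy => orbit_injective hp hm ?_, ?_⟩
  · funext j
    have := congrArg (Subtype.val : K → ℂ) (congrFun hxy j)
    simpa [hb, v] using this
  · intro f hf
    suffices ∀ x : OrbitIndex m (m / p) N,
        eval (fun j => b x j * v (x.1 j)) f = eval v f from
      fun x y => (this x).trans (this y).symm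
    intro x
    obtain ⟨g, hg, hgX⟩ := exists_mem_polyAct_X (m := m) (p := p) x.1
      (fun j => Units.mk0 (b x j) (hb0 x j)) (fun j => Units.ext (by simpa using hbpow x j))
      (Units.ext (by simpa [Units.coe_prod] using hbprod x))
    -- Evaluating `f` at the moved point is evaluating `polyAct g f` at the base point `v`.
    have hcomp : (aeval fun j => b x j * v (x.1 j) : MvPolynomial (Fin (N + 1)) K →ₐ[K] K) =
        (aeval v).comp (polyAct g) := by
      refine algHom_ext fun j => ?_
      simp [hgX, aeval_eq_eval]
    have := DFunLike.congr_fun hcomp f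
    rw [AlgHom.comp_apply, hf g hg] at this
    simpa [aeval_eq_eval] using this

end Orbit

/-! ### Counting monomials that avoid the leading monomials -/

section StandardMonomials

/-- Exponents bounded as for the standard monomials of `G(m, 1, N)`. -/
noncomputable def boxExponents (m N : ℕ) : Finset (Fin N →₀ ℕ) :=
  (Fintype.piFinset fun i : Fin N => Finset.range (m * (i + 1))).image Finsupp.equivFunOnFinite.symm

theorem prod_mul_succ (m N : ℕ) : ∏ i : Fin N, m * ((i : ℕ) + 1) = N.factorial * m ^ N := by
  rw [Finset.prod_mul_distrib, Finset.prod_const, Finset.card_univ, Fintype.card_fin, mul_comm,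
    Fin.prod_univ_eq_prod_range (fun i => i + 1), Finset.prod_range_add_one_eq_factorial]

theorem card_boxExponents_le (m N : ℕ) : (boxExponents m N).card ≤ N.factorial * m ^ N := by
  refine Finset.card_image_le.trans ?_
  simp [Fintype.card_piFinset, prod_mul_succ]

theorem mem_boxExponents {m N : ℕ} {c : Fin N →₀ ℕ} (h : ∀ i, c i < m * ((i : ℕ) + 1)) :
    c ∈ boxExponents m N :=
  Finset.mem_image.2 ⟨c, by simpa [Fintype.mem_piFinset] using h, by ext; rfl⟩

/-- The exponents of the standard monomials whose last exponent less than `q` is at index `k`. -/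
noncomputable def stairExponents (m q : ℕ) {N : ℕ} (k : Fin N) : Finset (Fin N →₀ ℕ) :=
  (Fintype.piFinset fun i : Fin N =>
    if i < k then Finset.range (m * (i + 1)) else
      if i = k then Finset.range q else Finset.Ico q (m * i + q)).image
    Finsupp.equivFunOnFinite.symm

/-- There are m(i+1) choices at each i < k, q at k, and m·i at each i > k. The product is the same
for every k, so the N + 1 values of k together give at most (N+1)! m^N q exponents. -/
theorem card_stairExponents_le (m q : ℕ) {N : ℕ} (k : Fin (N + 1)) :
    (stairExponents m q k).card ≤ N.factorial * (m ^ N * q) := by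
  refine Finset.card_image_le.trans (le_of_eq ?_)
  rw [Fintype.card_piFinset, Fin.prod_univ_succAbove _ k, if_neg (lt_irrefl k), if_pos rfl,
    Finset.card_range, ← mul_assoc, mul_comm, ← prod_mul_succ]
  congr 1
  refine Finset.prod_congr rfl fun i _ => ?_
  rcases lt_or_ge i.castSucc k with h | h
  · rw [Fin.succAbove_of_castSucc_lt _ _ h, if_pos h, Finset.card_range, Fin.val_castSucc]
  · rw [Fin.succAbove_of_le_castSucc _ _ h]
    have hk : k < i.succ := h.trans_lt Fin.castSucc_lt_succ
    rw [if_neg hk.le.not_gt, if_neg hk.ne', Nat.card_Ico, Nat.add_sub_cancel, Fin.val_succ]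

theorem exists_mem_stairExponents {m q N : ℕ} {c : Fin (N + 1) →₀ ℕ}
    (h1 : ∀ i : Fin (N + 1), (i : ℕ) + 1 ≤ N → c i < m * (i + 1))
    (h2 : ∀ i : Fin (N + 1), ¬ Finsupp.single i (m * i) + q • tailExponent i ≤ c) :
    ∃ k, c ∈ stairExponents m q k := by
  have hlast : ∀ i : Fin (N + 1), (∀ l, i ≤ l → q ≤ c l) → c i < m * i + q := by
    intro i hi
    by_contra! hc
    refine h2 i fun l => ?_
    by_cases hl : i = l
    · subst hl
      simpa using hc
    · by_cases hil : i ≤ l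
      · simpa [hl, hil] using hi l hil
      · simp [hl, hil]
  -- Were all exponents at least `q`, the leading monomial for index 0, namely (x_1 ⋯ x_n)^q, would
  -- divide.
  have hne : (Finset.univ.filter fun l => c l < q).Nonempty := by
    by_contra hempty
    rw [Finset.not_nonempty_iff_eq_empty, Finset.filter_eq_empty_iff] at hempty
    have h0 : ∀ l, q ≤ c l := fun l => not_lt.1 (hempty (Finset.mem_univ l))
    have := hlast 0 fun l _ => h0 l
    simp only [Fin.val_zero, mul_zero, zero_add] at this
    exact absurd this (not_lt.2 (h0 0))
  obtain ⟨k, hk, hmax⟩ := Finset.exists_max_image _ id hne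
  have hgt : ∀ l, k < l → q ≤ c l := fun l hl => not_lt.1 fun hlq =>
    absurd (hmax l (Finset.mem_filter.2 ⟨Finset.mem_univ l, hlq⟩)) (not_le.2 hl)
  refine ⟨k, Finset.mem_image.2 ⟨c, Fintype.mem_piFinset.2 fun i => ?_, by ext; rfl⟩⟩
  split_ifs with hik hik'
  · rw [Finset.mem_range]
    exact h1 i (by omega)
  · rw [Finset.mem_range, hik']
    exact (Finset.mem_filter.1 hk).2
  · have hki : k < i := lt_of_le_of_ne (not_lt.1 hik) (Ne.symm hik')
    rw [Finset.mem_Ico]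
    exact ⟨hgt i hki, hlast i fun l hl => hgt l (hki.trans_le hl)⟩

end StandardMonomials

/-! ### Exponent comparisons for reducedness -/

section Reduced

variable {n m q : ℕ} {i k : Fin n} {d : Fin n →₀ ℕ}

theorem eq_of_single_le_smul (hm : 0 < m) (hd : ∀ l < k, d l = 0) (hdeg : d.degree = k + 1)
    (h : Finsupp.single i (m * (i + 1)) ≤ m • d) : i = k := by
  have hi := Finsupp.single_le_iff.1 h
  rw [Finsupp.smul_apply, smul_eq_mul] at hi
  have hi' := Nat.le_of_mul_le_mul_left hi hm
  have hle := Finsupp.le_degree i d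
  have hki : ¬ i < k := fun hik => by
    have := hd i hik
    omega
  omega

theorem eq_of_tail_le_smul_add_tail (hm : 0 < m) (hq : 0 < q) (hd : ∀ l < k, d l = 0)
    (hdeg : d.degree = k)
    (h : Finsupp.single i (m * i) + q • tailExponent i ≤ m • d + q • tailExponent k) : i = k := by
  have hi := h i
  simp only [Finsupp.add_apply, Finsupp.single_eq_same, Finsupp.smul_apply, smul_eq_mul,
    tailExponent_apply, le_refl, if_true, mul_one] at hi
  by_cases hki : k ≤ i
  · rw [if_pos hki, mul_one] at hi
    have hi' := Nat.le_of_mul_le_mul_left (Nat.le_of_add_le_add_right hi) hm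
    have hle := Finsupp.le_degree i d
    omega
  · rw [if_neg hki, hd i (not_le.1 hki)] at hi
    omega

/-- For i ≥ k the exponent at i is at most m·i + q, which is below m(i+1) because q < m; this is
where p > 1 enters. -/
theorem not_single_le_smul_add_tail (hq : q < m) (hd : ∀ l < k, d l = 0) (hdeg : d.degree = k) :
    ¬ Finsupp.single i (m * (i + 1)) ≤ m • d + q • tailExponent k := by
  intro h
  have hi := Finsupp.single_le_iff.1 h
  simp only [Finsupp.add_apply, Finsupp.smul_apply, smul_eq_mul, tailExponent_apply] at hi
  by_cases hki : k ≤ i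
  · rw [if_pos hki, mul_one] at hi
    have hle := Finsupp.le_degree i d
    have : m * d i ≤ m * i := Nat.mul_le_mul_left m (by omega)
    rw [mul_add] at hi
    omega
  · rw [if_neg hki, hd i (not_le.1 hki)] at hi
    have : 0 < m * ((i : ℕ) + 1) := Nat.mul_pos (by omega) (by omega)
    omega

/-- Divisibility at index i forces i = k and d concentrated at k. The last variable then has
exponent 0 on the right, but at least q on the left; `hk` ensures that k is not the last index. -/
theorem not_tail_le_smul (hq : 0 < q) (hk : (k : ℕ) + 1 ≤ n - 1) (hd : ∀ l < k, d l = 0)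
    (hdeg : d.degree = k + 1) : ¬ Finsupp.single i (m * i) + q • tailExponent i ≤ m • d := by
  intro h
  have hi := h i
  obtain ⟨e, he⟩ : ∃ e : Fin n, (e : ℕ) = n - 1 := ⟨⟨n - 1, by omega⟩, rfl⟩
  have hlast := h e
  simp only [Finsupp.add_apply, Finsupp.single_eq_same, Finsupp.smul_apply, smul_eq_mul,
    tailExponent_apply, le_refl, if_true, mul_one] at hi hlast
  rw [if_pos (Fin.le_def.2 (by omega)), mul_one] at hlast
  have hlt : (i : ℕ) < d i := lt_of_mul_lt_mul_left (a := m) (by omega) (Nat.zero_le m)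
  have hki : k ≤ i := not_lt.1 fun hik => by
    have := hd i hik
    omega
  have hle := Finsupp.le_degree i d
  have hik : i = k := by omega
  have hne : e ≠ i := by
    rintro rfl
    omega
  rw [Finsupp.eq_single_of_degree_le (d := d) (i := i) (by omega), Finsupp.single_eq_of_ne hne,
    Finsupp.single_eq_of_ne hne] at hlast
  omega

end Reduced

/-! ### Assembling the Gröbner bases -/

section Main

open MvPolynomial

variable {F : Type*} [Field F] {n m p : ℕ}

theorem finite_hSet (N : ℕ) : (hSet F n m N).Finite :=
  (Set.finite_range fun i : Fin n => hTail F m i (i + 1)).subset fun _ ⟨i, _, h⟩ => ⟨i, h.symm⟩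

theorem finite_hxSet : (hxSet F n m p).Finite :=
  (Set.finite_range fun i : Fin n => hTail F m i i * xTail F i ^ (m / p)).subset
    fun _ ⟨i, h⟩ => ⟨i, h.symm⟩

theorem hSet_subset_coinvariantIdeal (hm : m ≠ 0) (N : ℕ) :
    hSet F n m N ⊆
      (coinvariantIdeal (shephardToddGroup F m p n) : Set (MvPolynomial (Fin n) F)) := by
  rintro _ ⟨i, -, rfl⟩
  exact hTail_mem_coinvariantIdeal hm i i.2 _ le_rfl

theorem hxSet_subset_coinvariantIdeal (hm : m ≠ 0) (hp : p ∣ m) :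
    hxSet F n m p ⊆
      (coinvariantIdeal (shephardToddGroup F m p n) : Set (MvPolynomial (Fin n) F)) := by
  rintro _ ⟨i, rfl⟩
  exact hTail_mul_xTail_mem_coinvariantIdeal hm hp i i.2

theorem monic_of_mem_hSet (hm : m ≠ 0) {N : ℕ} {g : MvPolynomial (Fin n) F}
    (hg : g ∈ hSet F n m N) : MonomialOrder.lex.Monic g := by
  obtain ⟨i, -, rfl⟩ := hg
  exact monic_hTail hm _ _

theorem monic_of_mem_hxSet (hm : m ≠ 0) {g : MvPolynomial (Fin n) F}
    (hg : g ∈ hxSet F n m p) : MonomialOrder.lex.Monic g := by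
  obtain ⟨i, rfl⟩ := hg
  exact monic_hTail_mul_xTail hm _ _ _

/-- A common element would have its leading monomial, of the second type, in the support of a
polynomial of the first type. -/
theorem disjoint_hSet_hxSet (hm : m ≠ 0) (hq : 0 < m / p) :
    Disjoint (hSet F n m (n - 1)) (hxSet F n m p) := by
  rw [Set.disjoint_left]
  rintro _ ⟨k, hk, rfl⟩ ⟨i, hi⟩
  have hc := MonomialOrder.lex.degree_mem_support (monic_hTail (F := F) hm k (k + 1)).ne_zero
  obtain ⟨d, hd, hdeg, hc⟩ := (mem_support_hTail hm).1 hc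
  refine not_tail_le_smul (i := i) (m := m) hq hk hd hdeg ?_
  rw [← hc, hi, degree_hTail_mul_xTail hm]

theorem IsGroebnerBasis.of_card_le {K : Subfield ℂ} {m p N : ℕ} (hp : p ∣ m) (hm : m ≠ 0)
    (hK : ∀ A ∈ shephardToddGroup ℂ m p (N + 1), ∀ i j,
      (A : Matrix (Fin (N + 1)) (Fin (N + 1)) ℂ) i j ∈ K)
    {μ : MonomialOrder (Fin (N + 1))} {S : Set (MvPolynomial (Fin (N + 1)) K)} (hfin : S.Finite)
    (hsub : S ⊆ (coinvariantIdeal (shephardToddGroup K m p (N + 1)) :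
      Set (MvPolynomial (Fin (N + 1)) K)))
    (hmonic : ∀ g ∈ S, μ.Monic g) {D : Finset (Fin (N + 1) →₀ ℕ)}
    (hD : ∀ c, (∀ g ∈ S, ¬ μ.degree g ≤ c) → c ∈ D)
    (hcard : D.card ≤ (N + 1).factorial * (m ^ N * (m / p))) :
    IsGroebnerBasis μ (coinvariantIdeal (shephardToddGroup K m p (N + 1))) S := by
  have : NeZero m := ⟨hm⟩
  have : NeZero (m / p) := ⟨(Nat.div_pos (Nat.le_of_dvd (by omega) hp)
    (Nat.pos_of_dvd_of_pos hp (by omega))).ne'⟩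
  obtain ⟨w, hinj, hw⟩ := exists_orbit_points hp hm hK
  refine IsGroebnerBasis.of_exists_degree_le hfin hsub hmonic fun f hf hf0 => ?_
  refine exists_degree_le_of_card_le hinj (fun t ht => ht.1) (fun t ht => hw t ht.2) hsub
    (fun g hg => (hmonic g hg).ne_zero) hD ?_ hf hf0
  rwa [card_orbitIndex]

theorem isReducedGroebnerBasis_hSet {K : Subfield ℂ} {m N : ℕ} (hm : m ≠ 0)
    (hK : ∀ A ∈ shephardToddGroup ℂ m 1 (N + 1), ∀ i j,
      (A : Matrix (Fin (N + 1)) (Fin (N + 1)) ℂ) i j ∈ K) :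
    IsReducedGroebnerBasis MonomialOrder.lex
      (coinvariantIdeal (shephardToddGroup K m 1 (N + 1))) (hSet K (N + 1) m (N + 1)) where
  toIsGroebnerBasis := by
    refine IsGroebnerBasis.of_card_le (one_dvd m) hm hK (finite_hSet _)
      (hSet_subset_coinvariantIdeal hm _) (fun g hg => monic_of_mem_hSet hm hg)
      (D := boxExponents m (N + 1)) (fun c hc => mem_boxExponents fun i => ?_) ?_
    · have := hc _ ⟨i, i.2, rfl⟩
      rw [degree_hTail hm, Finsupp.single_le_iff] at this
      exact not_le.1 this
    · rw [Nat.div_one, ← pow_succ]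
      exact card_boxExponents_le m (N + 1)
  monic := fun g hg => monic_of_mem_hSet hm hg
  reduced := by
    rintro _ ⟨i, -, rfl⟩ _ ⟨k, -, rfl⟩ hne c hc hle
    obtain ⟨d, hd, hdeg, rfl⟩ := (mem_support_hTail hm).1 hc
    rw [degree_hTail hm] at hle
    exact hne (by rw [eq_of_single_le_smul (Nat.pos_of_ne_zero hm) hd hdeg hle])

theorem isReducedGroebnerBasis_hSet_union_hxSet {K : Subfield ℂ} {m p N : ℕ} (hm : m ≠ 0)
    (hp : p ∣ m) (hp1 : 1 < p)
    (hK : ∀ A ∈ shephardToddGroup ℂ m p (N + 1), ∀ i j,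
      (A : Matrix (Fin (N + 1)) (Fin (N + 1)) ℂ) i j ∈ K) :
    IsReducedGroebnerBasis MonomialOrder.lex
      (coinvariantIdeal (shephardToddGroup K m p (N + 1)))
      (hSet K (N + 1) m (N + 1 - 1) ∪ hxSet K (N + 1) m p) := by
  have hm0 : 0 < m := Nat.pos_of_ne_zero hm
  have hq : 0 < m / p := Nat.div_pos (Nat.le_of_dvd hm0 hp) (by omega)
  have hqm : m / p < m := Nat.div_lt_self hm0 hp1
  have hmonic : ∀ g ∈ hSet K (N + 1) m (N + 1 - 1) ∪ hxSet K (N + 1) m p,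
      MonomialOrder.lex.Monic g := fun g hg =>
    hg.elim (monic_of_mem_hSet hm) (monic_of_mem_hxSet hm)
  refine ⟨?_, hmonic, ?_⟩
  · classical
    refine IsGroebnerBasis.of_card_le hp hm hK ((finite_hSet _).union finite_hxSet)
      (Set.union_subset (hSet_subset_coinvariantIdeal hm _) (hxSet_subset_coinvariantIdeal hm hp))
      hmonic (D := Finset.univ.biUnion fun k => stairExponents m (m / p) k) (fun c hc => ?_) ?_
    · obtain ⟨k, hk⟩ := exists_mem_stairExponents (m := m) (q := m / p) (c := c)
        (fun i hi => by
          have := hc _ (Or.inl ⟨i, hi, rfl⟩)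
          rw [degree_hTail hm, Finsupp.single_le_iff] at this
          exact not_le.1 this)
        (fun i => by
          have := hc _ (Or.inr ⟨i, rfl⟩)
          rwa [degree_hTail_mul_xTail hm] at this)
      exact Finset.mem_biUnion.2 ⟨k, Finset.mem_univ k, hk⟩
    · refine (Finset.card_biUnion_le_card_mul _ _ _ fun k _ =>
        card_stairExponents_le m (m / p) k).trans (le_of_eq ?_)
      rw [Finset.card_univ, Fintype.card_fin, Nat.factorial_succ, mul_assoc]
  · rintro _ (⟨i, -, rfl⟩ | ⟨i, rfl⟩) _ (⟨k, hk, rfl⟩ | ⟨k, rfl⟩) hne c hc hle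
    · obtain ⟨d, hd, hdeg, rfl⟩ := (mem_support_hTail hm).1 hc
      rw [degree_hTail hm] at hle
      exact hne (by rw [eq_of_single_le_smul hm0 hd hdeg hle])
    · obtain ⟨d, hd, hdeg, rfl⟩ := exists_of_mem_support_hTail_mul_xTail hm hc
      rw [degree_hTail hm] at hle
      exact not_single_le_smul_add_tail hqm hd hdeg hle
    · obtain ⟨d, hd, hdeg, rfl⟩ := (mem_support_hTail hm).1 hc
      rw [degree_hTail_mul_xTail hm] at hle
      exact not_tail_le_smul hq hk hd hdeg hle
    · obtain ⟨d, hd, hdeg, rfl⟩ := exists_of_mem_support_hTail_mul_xTail hm hc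
      rw [degree_hTail_mul_xTail hm] at hle
      exact hne (by rw [eq_of_tail_le_smul_add_tail hm0 hq hd hdeg hle])

end Main

theorem mainTheorem8 (K : Subfield ℂ) (m p n : ℕ) (hm : 1 ≤ m) (hn : 1 ≤ n) (hp : p ∣ m)
    (hK : ∀ A ∈ shephardToddGroup ℂ m p n, ∀ i j, (A : Matrix (Fin n) (Fin n) ℂ) i j ∈ K) :
    (p = 1 → ∀ S : Set (MvPolynomial (Fin n) K),
      IsReducedGroebnerBasis MonomialOrder.lex (coinvariantIdeal (shephardToddGroup K m p n)) S ↔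
        S = hSet K n m n) ∧
    (1 < p → Disjoint (hSet K n m (n - 1)) (hxSet K n m p) ∧
      ∀ S : Set (MvPolynomial (Fin n) K),
        IsReducedGroebnerBasis MonomialOrder.lex (coinvariantIdeal (shephardToddGroup K m p n)) S ↔
          S = hSet K n m (n - 1) ∪ hxSet K n m p) := by
  obtain ⟨N, rfl⟩ : ∃ N, n = N + 1 := ⟨n - 1, by omega⟩
  have hm0 : m ≠ 0 := by omega
  refine ⟨?_, fun hp1 => ⟨?_, fun S => ?_⟩⟩
  · rintro rfl S
    exact (isReducedGroebnerBasis_hSet hm0 hK).iff_eq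
  · exact disjoint_hSet_hxSet hm0 (Nat.div_pos (Nat.le_of_dvd hm hp) (by omega))
  · exact (isReducedGroebnerBasis_hSet_union_hxSet hm0 hp hp1 hK).iff_eq
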